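/- **Definitions.** In a monoid $M$, write $g \preceq h$ if $h = gh'$ for some $h' \in M$ ($g$ is a left-divisor of $h$), and $h \succsim g$ if $h = h'g$ for some $h' \in M$ ($g$ is a right-divisor of $h$). The monoid $M$ is of *$O$-type* if it is left- and right-cancellative, $1$ is its only invertible element, and for all $g,h\in M$ one has ($g \preceq h$ or $h \preceq g$) and ($g \succsim h$ or $h \succsim g$). An element $\delta \in M$ *dominates* $g\in M$ if $g\delta^n \preceq \delta^{n+1}$ and $\delta^{n+1} \succsim \delta^n g$ for every $n \ge 0$. A group $G$ is *left-orderable* if it has a linear ordering $<$ that is left-invariant ($g<g'$ implies $hg<hg'$); the positive cone of $<$ is $\{g\in G : 1<g\}$. The set $\mathrm{LO}(G)$ of all left-invariant linear orderings of $G$, viewed as subsets of $G\times G$, carries the topology induced by the product topology on $\{0,1\}^{G\times G}$ (with $\{0,1\}$ discrete); an ordering is *isolated* if it is an isolated point of $\mathrm{LO}(G)$. **Statement.** Let $p,q,r,s \ge 0$ be integers. 1. If $r \ge p$, then the group $G = \langle x,y \mid x^{p+1} = (y(x^{r-p}y)^s)^{q+1}\rangle$ is left-orderable, and the subsemigroup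 of $G$ generated by $x$ and $yx^{-p}$ is the positive cone of a left-invariant ordering on $G$ that is isolated in $\mathrm{LO}(G)$. 2. Let $M$ be the monoid with generators $a,b,c$ and relations $a = b(a^pb)^q$, $b = c(a^rc)^s$. If $r \ge p$ or $q = 0$, then $a$ dominates $a$, $b$ and $c$ in $M$, and $M$ is of $O$-type. If $r < p$, $q \ge 1$ and $s \ge 1$, then $M$ is not of $O$-type. -/

import Mathlib

namespace OTypeMonoid

/-! ### Monoids of `O`-type

In a (noncommutative) monoid, Mathlib's `g ∣ h` means `∃ h', h = g * h'`, i.e. `g` is a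
left-divisor of `h`. -/

/-- `g` is a right-divisor of `h`. -/
def RightDivides {M : Type*} [Monoid M] (g h : M) : Prop := ∃ h' : M, h = h' * g

/-- A monoid is of right-`O`-type if it is left-cancellative, `1` is its only invertible element,
and any two elements are comparable for left-divisibility. -/
structure IsRightOType (M : Type*) [Monoid M] : Prop where
  cancel : ∀ h g g' : M, h * g = h * g' → g = g'
  eq_one : ∀ g : M, IsUnit g → g = 1
  total : ∀ g h : M, g ∣ h ∨ h ∣ g

/-- A monoid is of left-`O`-type if it is right-cancellative, `1` is its only invertible element,
and any two elements are comparable for right-divisibility. -/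
structure IsLeftOType (M : Type*) [Monoid M] : Prop where
  cancel : ∀ h g g' : M, g * h = g' * h → g = g'
  eq_one : ∀ g : M, IsUnit g → g = 1
  total : ∀ g h : M, RightDivides g h ∨ RightDivides h g

/-- A monoid is of `O`-type if it is both of right- and of left-`O`-type. -/
def IsOType (M : Type*) [Monoid M] : Prop := IsRightOType M ∧ IsLeftOType M

/-- `δ` right-dominates `g` if `g δ ^ n` left-divides `δ ^ (n + 1)` for every `n`. -/
def RightDominates {M : Type*} [Monoid M] (δ g : M) : Prop :=
  ∀ n : ℕ, g * δ ^ n ∣ δ ^ (n + 1)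

/-- `δ` left-dominates `g` if `δ ^ n g` right-divides `δ ^ (n + 1)` for every `n`. -/
def LeftDominates {M : Type*} [Monoid M] (δ g : M) : Prop :=
  ∀ n : ℕ, RightDivides (δ ^ n * g) (δ ^ (n + 1))

/-- `δ` dominates `g` if it does so on both sides. -/
def Dominates {M : Type*} [Monoid M] (δ g : M) : Prop :=
  RightDominates δ g ∧ LeftDominates δ g

/-! ### The space of left-invariant orderings of a group -/

/-- A left-invariant (strict) linear ordering on a group. -/
@[ext]
structure LeftOrdering (G : Type*) [Group G] where
  lt : G → G → Prop
  irrefl : ∀ g, ¬ lt g g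
  trans : ∀ g h k, lt g h → lt h k → lt g k
  trichotomous : ∀ g h, lt g h ∨ g = h ∨ lt h g
  mul_left : ∀ h g g', lt g g' → lt (h * g) (h * g')

/-- A group is (left-)orderable if it has a left-invariant linear ordering. -/
def LeftOrderable (G : Type*) [Group G] : Prop := Nonempty (LeftOrdering G)

/-- The positive cone of a left-invariant ordering. -/
def LeftOrdering.positiveCone {G : Type*} [Group G] (L : LeftOrdering G) : Set G :=
  {g | L.lt 1 g}

open Classical in
/-- The topology of `LO(G)`: a left-invariant ordering is viewed as a subset of `G × G`, i.e. as a
point of the product `{false, true} ^ (G × G)` of discrete two-point spaces, and `LO(G)` carries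
the induced topology. -/
noncomputable instance LeftOrdering.instTopologicalSpace {G : Type*} [Group G] :
    TopologicalSpace (LeftOrdering G) :=
  TopologicalSpace.induced
    (fun (L : LeftOrdering G) (z : G × G) => decide (L.lt z.1 z.2))
    (inferInstance : TopologicalSpace (G × G → Bool))

/-- An ordering is isolated in `LO(G)` if it is an isolated point of that space. -/
def LeftOrdering.Isolated {G : Type*} [Group G] (L : LeftOrdering G) : Prop :=
  IsOpen ({L} : Set (LeftOrdering G))

/-! ### The group `⟨x, y ∣ x ^ (p+1) = (y (x ^ (r-p) y) ^ s) ^ (q+1)⟩` -/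

/-- The two generators of the group. -/
inductive Gen₂
  | x
  | y

open FreeGroup in
/-- The group with generators `x, y` and the single relation
`x ^ (p+1) = (y (x ^ (r-p) y) ^ s) ^ (q+1)`. It is only used for `p ≤ r`. -/
abbrev Gp (p q r s : ℕ) : Type :=
  PresentedGroup
    ({of Gen₂.x ^ (p + 1) *
      ((of Gen₂.y * (of Gen₂.x ^ (r - p) * of Gen₂.y) ^ s) ^ (q + 1))⁻¹} : Set (FreeGroup Gen₂))

/-- The generator `x` of the group. -/
def Gp.x (p q r s : ℕ) : Gp p q r s := PresentedGroup.of Gen₂.x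

/-- The generator `y` of the group. -/
def Gp.y (p q r s : ℕ) : Gp p q r s := PresentedGroup.of Gen₂.y

/-! ### The monoid `⟨a, b, c ∣ a = b (a ^ p b) ^ q, b = c (a ^ r c) ^ s⟩⁺` -/

/-- The three generators of the monoid. -/
inductive Gen₃
  | a
  | b
  | c

open FreeMonoid in
/-- The two defining relations `a = b (a ^ p b) ^ q` and `b = c (a ^ r c) ^ s`. -/
inductive MonRel (p q r s : ℕ) : FreeMonoid Gen₃ → FreeMonoid Gen₃ → Prop
  | rel_a : MonRel p q r s (of Gen₃.a) (of Gen₃.b * (of Gen₃.a ^ p * of Gen₃.b) ^ q)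
  | rel_b : MonRel p q r s (of Gen₃.b) (of Gen₃.c * (of Gen₃.a ^ r * of Gen₃.c) ^ s)

/-- The monoid presented by `a, b, c` and the two relations above. -/
abbrev Mon (p q r s : ℕ) : Type := PresentedMonoid (MonRel p q r s)

/-- The generator `a` of the monoid. -/
def Mon.a (p q r s : ℕ) : Mon p q r s := PresentedMonoid.of _ Gen₃.a

/-- The generator `b` of the monoid. -/
def Mon.b (p q r s : ℕ) : Mon p q r s := PresentedMonoid.of _ Gen₃.b

/-- The generator `c` of the monoid. -/
def Mon.c (p q r s : ℕ) : Mon p q r s := PresentedMonoid.of _ Gen₃.c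

end OTypeMonoid

/-!
Eliminating `b` inside `a` turns the presentation of `M` into one relation `x = c * R x` for each
generator `x`, with `R c = 1`. In a derivation between two words that changes the first letter at
some point, that letter may be expanded throughout; deleting the common initial `c` then makes the
derivation shorter. Induction on the length of derivations shows that `M` is left-cancellative and
that any two elements with a common right-multiple are comparable for left-divisibility.

Common right-multiples come from the domination by `a`, which reduces to the conjugates of
`b * a ^ p` and `c * a ^ r` by powers of `a` staying in `M`. The elements with this property form a
submonoid that is closed under the extraction of certain roots, and the relations give
`(b * a ^ p) ^ (q + 1) = a ^ (p + 1)` and `(c * a ^ r) ^ (s + 1) = b * a ^ r`. As the relations are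
palindromic, `M` has an anti-automorphism fixing the generators, so everything holds on both sides.

When a monoid of `O`-type generates a group containing it, its nontrivial elements form the
positive cone of a left-invariant ordering of the group. If this cone is finitely generated, then
the ordering is isolated, since the positive cones of distinct orderings are never nested. To see
that `M` embeds in the presented group, map the latter to the group of fractions of `M`.

If `r < p`, then `c * a ^ p` and `a ^ (p - r)` are not comparable: a derivation between
right-multiples of words `c * (a ^ r * c) ^ i * a ^ p` with `i < s` and `a ^ (p - r)` contains a
shorter one of the same kind.
-/

namespace OTypeMonoid

open FreeMonoid (of)

/-! ### Presentations in which every letter expands to a word starting with the same letter -/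

section HeadExpansion

variable {S : Type*} {c : S} {R : S → FreeMonoid S}

theorem of_mul_inj {x y : S} {u v : FreeMonoid S} (h : of x * u = of y * v) : x = y ∧ u = v :=
  List.cons.inj h

/-- Elementary steps between words for the presentation with one relation `x = c * R x` for each
letter `x`. Splitting off unchanged first letters one at a time (`cons`) makes the first letter of
the source accessible to case analysis. -/
inductive HeadStep (c : S) (R : S → FreeMonoid S) : FreeMonoid S → FreeMonoid S → Prop
  | expand (x : S) (u : FreeMonoid S) : HeadStep c R (of x * u) (of c * (R x * u))
  | contract (x : S) (u : FreeMonoid S) : HeadStep c R (of c * (R x * u)) (of x * u)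
  | cons (x : S) {u v : FreeMonoid S} : HeadStep c R u v → HeadStep c R (of x * u) (of x * v)

namespace HeadStep

theorem symm {u v : FreeMonoid S} (h : HeadStep c R u v) : HeadStep c R v u := by
  induction h with
  | expand x u => exact .contract x u
  | contract x u => exact .expand x u
  | cons x _ ih => exact .cons x ih

theorem mul_left (w : FreeMonoid S) {u v : FreeMonoid S} (h : HeadStep c R u v) :
    HeadStep c R (w * u) (w * v) := by
  induction w using FreeMonoid.inductionOn' with
  | one => exact h
  | of_mul x w ih => simpa only [mul_assoc] using ih.cons x

theorem mul_right (w : FreeMonoid S) {u v : FreeMonoid S} (h : HeadStep c R u v) :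
    HeadStep c R (u * w) (v * w) := by
  induction h with
  | expand x u => simpa only [mul_assoc] using expand x (u * w)
  | contract x u => simpa only [mul_assoc] using contract x (u * w)
  | cons x _ ih => simpa only [mul_assoc] using ih.cons x

/-- The word obtained by expanding the first letter and deleting the resulting `c` is an invariant
of the steps that involve the first letter. -/
theorem of_mul_left (hc : R c = 1) {x : S} {u w : FreeMonoid S} (h : HeadStep c R (of x * u) w) :
    ∃ y v, w = of y * v ∧ (x = y ∧ HeadStep c R u v ∨ R x * u = R y * v) := by
  generalize hxu : of x * u = t at h
  cases h with
  | expand x' u' =>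
    obtain ⟨rfl, rfl⟩ := of_mul_inj hxu
    exact ⟨c, R x * u, rfl, .inr (by rw [hc, one_mul])⟩
  | contract y u' =>
    obtain ⟨rfl, rfl⟩ := of_mul_inj hxu
    exact ⟨y, u', rfl, .inr (by rw [hc, one_mul])⟩
  | @cons x' u' v h =>
    obtain ⟨rfl, rfl⟩ := of_mul_inj hxu
    exact ⟨x, v, rfl, .inl ⟨rfl, h⟩⟩

end HeadStep

/-- `HeadDeriv c R n u v` says that `v` can be reached from `u` in at most `n` elementary steps. -/
inductive HeadDeriv (c : S) (R : S → FreeMonoid S) : ℕ → FreeMonoid S → FreeMonoid S → Prop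
  | refl (n : ℕ) (u : FreeMonoid S) : HeadDeriv c R n u u
  | step {n : ℕ} {u v w : FreeMonoid S} :
      HeadStep c R u v → HeadDeriv c R n v w → HeadDeriv c R (n + 1) u w

namespace HeadDeriv

variable {m n : ℕ} {u v w : FreeMonoid S}

theorem mono (hmn : m ≤ n) (h : HeadDeriv c R m u v) : HeadDeriv c R n u v := by
  induction h generalizing n with
  | refl => exact .refl n _
  | step hs _ ih =>
    obtain ⟨k, rfl⟩ := Nat.exists_eq_add_of_le' hmn
    exact .step hs (ih (by lia))

theorem trans (h : HeadDeriv c R m u v) (h' : HeadDeriv c R n v w) :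
    HeadDeriv c R (m + n) u w := by
  induction h with
  | refl => exact h'.mono (Nat.le_add_left n _)
  | step hs _ ih => exact (HeadDeriv.step hs (ih h')).mono (by lia)

theorem symm (h : HeadDeriv c R n u v) : HeadDeriv c R n v u := by
  induction h with
  | refl n u => exact .refl n u
  | step hs _ ih => exact ih.trans (.step hs.symm (.refl 0 _))

theorem mul_left (w : FreeMonoid S) (h : HeadDeriv c R n u v) :
    HeadDeriv c R n (w * u) (w * v) := by
  induction h with
  | refl n u => exact .refl n _
  | step hs _ ih => exact .step (hs.mul_left w) ih

theorem mul_right (w : FreeMonoid S) (h : HeadDeriv c R n u v) :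
    HeadDeriv c R n (u * w) (v * w) := by
  induction h with
  | refl n u => exact .refl n _
  | step hs _ ih => exact .step (hs.mul_right w) ih

theorem eq_one (h : HeadDeriv c R n u v) (hv : v = 1) : u = 1 := by
  induction h with
  | refl => exact hv
  | step hs _ ih => cases hs <;> cases ih hv

theorem of_mul_of_mul (hc : R c = 1) {x y : S} (h : HeadDeriv c R n (of x * u) (of y * v)) :
    (x = y ∧ HeadDeriv c R n u v) ∨ ∃ m < n, HeadDeriv c R m (R x * u) (R y * v) := by
  generalize hs : of x * u = s, ht : of y * v = t at h
  induction h generalizing x u with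
  | refl n =>
    obtain ⟨rfl, rfl⟩ := of_mul_inj (hs.trans ht.symm)
    exact .inl ⟨rfl, .refl n u⟩
  | @step n _ _ _ hstep _ ih =>
    subst hs
    obtain ⟨z, w, rfl, ⟨rfl, htail⟩ | hinv⟩ := hstep.of_mul_left hc
    · rcases ih rfl ht with ⟨rfl, hd⟩ | ⟨m, hm, hd⟩
      · exact .inl ⟨rfl, .step htail hd⟩
      · exact .inr ⟨m + 1, by lia, .step (htail.mul_left _) hd⟩
    · rw [hinv]
      rcases ih rfl ht with ⟨rfl, hd⟩ | ⟨m, hm, hd⟩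
      · exact .inr ⟨n, n.lt_succ_self, hd.mul_left _⟩
      · exact .inr ⟨m, by lia, hd⟩

theorem of_mul_left_cancel (hc : R c = 1) (h : HeadDeriv c R n (w * u) (w * v)) :
    HeadDeriv c R n u v := by
  induction n using Nat.strong_induction_on generalizing u v w with
  | _ n ihn =>
    induction w using FreeMonoid.inductionOn' with
    | one => exact h
    | of_mul x w ihw =>
      rw [mul_assoc, mul_assoc] at h
      rcases h.of_mul_of_mul hc with ⟨-, h⟩ | ⟨m, hm, h⟩
      · exact ihw h
      · rw [← mul_assoc, ← mul_assoc] at h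
        exact (ihn m hm h).mono hm.le

end HeadDeriv

/-- The congruence on words generated by the relations `x = c * R x`, for all letters `x`. -/
def headCon (c : S) (R : S → FreeMonoid S) : Con (FreeMonoid S) where
  r u v := ∃ n, HeadDeriv c R n u v
  iseqv :=
    { refl := fun u => ⟨0, .refl 0 u⟩
      symm := fun ⟨n, h⟩ => ⟨n, h.symm⟩
      trans := fun ⟨_, h⟩ ⟨_, h'⟩ => ⟨_, h.trans h'⟩ }
  mul' := fun ⟨_, h⟩ ⟨_, h'⟩ => ⟨_, (h.mul_right _).trans (h'.mul_left _)⟩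

theorem headCon_expand (c : S) (R : S → FreeMonoid S) (x : S) :
    headCon c R (of x) (of c * R x) :=
  ⟨1, .step (by simpa only [mul_one] using HeadStep.expand x 1) (.refl 0 _)⟩

theorem headCon_le {d : Con (FreeMonoid S)} (hd : ∀ x, d (of x) (of c * R x)) :
    headCon c R ≤ d := by
  have step {u v : FreeMonoid S} (h : HeadStep c R u v) : d u v := by
    induction h with
    | expand x u => simpa only [mul_assoc] using d.mul (hd x) (d.refl u)
    | contract x u => simpa only [mul_assoc] using d.mul (d.symm (hd x)) (d.refl u)
    | cons x _ ih => exact d.mul (d.refl (of x)) ih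
  rintro u v ⟨n, h⟩
  induction h with
  | refl _ u => exact d.refl u
  | step hs _ ih => exact d.trans (step hs) ih

theorem coe_headCon_eq_one_iff {u : FreeMonoid S} :
    (u : (headCon c R).Quotient) = 1 ↔ u = 1 := by
  refine ⟨fun h => ?_, fun h => h ▸ rfl⟩
  obtain ⟨n, hn⟩ := (headCon c R).eq.1 (h.trans Con.coe_one.symm)
  exact hn.eq_one rfl

theorem headCon_eq_one_of_isUnit {g : (headCon c R).Quotient} (hg : IsUnit g) : g = 1 := by
  obtain ⟨g', h⟩ := hg.exists_right_inv
  induction g, g' using Con.induction_on₂ with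
  | _ u v =>
    rw [← Con.coe_mul, coe_headCon_eq_one_iff] at h
    rw [coe_headCon_eq_one_iff]
    exact (List.append_eq_nil_iff.1 h).1

theorem headCon_isLeftCancelMul (hc : R c = 1) : IsLeftCancelMul (headCon c R).Quotient where
  mul_left_cancel g h h' e := by
    induction g using Con.induction_on with | _ u
    induction h, h' using Con.induction_on₂ with | _ v v'
    obtain ⟨n, hn⟩ := (headCon c R).eq.1 e
    exact (headCon c R).eq.2 ⟨n, hn.of_mul_left_cancel hc⟩

/-- Any two left-divisors of a common element are comparable for left-divisibility. A monoid of
right-`O`-type is a left-cancellative monoid without nontrivial units that has this property and in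
which any two elements have a common right-multiple. -/
def DivisorsComparable (M : Type*) [Monoid M] : Prop :=
  ∀ ⦃g h k : M⦄, g ∣ k → h ∣ k → g ∣ h ∨ h ∣ g

theorem HeadDeriv.dvd_or_dvd (hc : R c = 1) {n : ℕ} {u u' v v' : FreeMonoid S}
    (h : HeadDeriv c R n (u * u') (v * v')) :
    (u : (headCon c R).Quotient) ∣ v ∨ (v : (headCon c R).Quotient) ∣ u := by
  have expand (x : S) (u : FreeMonoid S) :
      ((of x * u : FreeMonoid S) : (headCon c R).Quotient) = of c * (R x * u : FreeMonoid S) := by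
    rw [← Con.coe_mul, ← mul_assoc]
    exact (headCon c R).eq.2 ((headCon c R).mul (headCon_expand c R x) ((headCon c R).refl u))
  induction n using Nat.strong_induction_on generalizing u v with
  | _ n ihn =>
    induction u using FreeMonoid.inductionOn' generalizing v with
    | one => exact .inl (one_dvd _)
    | of_mul x u ihu =>
      cases v using FreeMonoid.casesOn with
      | one => exact .inr (one_dvd _)
      | of_mul y v =>
        rw [mul_assoc, mul_assoc] at h
        rcases h.of_mul_of_mul hc with ⟨rfl, htail⟩ | ⟨m, hm, hshort⟩
        · rw [Con.coe_mul, Con.coe_mul]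
          exact (ihu htail).imp (mul_dvd_mul_left _) (mul_dvd_mul_left _)
        · rw [expand, expand]
          rw [← mul_assoc, ← mul_assoc] at hshort
          exact (ihn m hm hshort).imp (mul_dvd_mul_left _) (mul_dvd_mul_left _)

theorem headCon_divisorsComparable (hc : R c = 1) :
    DivisorsComparable (headCon c R).Quotient := by
  rintro g h _ ⟨g', rfl⟩ ⟨h', e⟩
  induction g, g' using Con.induction_on₂ with | _ u u'
  induction h, h' using Con.induction_on₂ with | _ v v'
  obtain ⟨n, hn⟩ := (headCon c R).eq.1 e
  exact hn.dvd_or_dvd hc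

end HeadExpansion

/-! ### Domination -/

section Domination

variable {M : Type*} [Monoid M]

theorem dvd_mul_of_dvd_pow_mul {w g : M} {n : ℕ} (h : g ∣ w * g ∨ w * g ∣ g)
    (hn : g ∣ w ^ (n + 1) * g) : g ∣ w * g := by
  refine h.elim id fun h => ?_
  have pow_dvd (j : ℕ) : w ^ j * g ∣ g := by
    induction j with
    | zero => rw [pow_zero, one_mul]
    | succ j ih =>
      rw [pow_succ', mul_assoc]
      exact (mul_dvd_mul_left w ih).trans h
  rw [pow_succ', mul_assoc] at hn
  exact hn.trans (mul_dvd_mul_left w (pow_dvd n))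

/-- The elements `w` all of whose conjugates `δ⁻ᵏ w δᵏ`, computed in a group of fractions, lie in
the monoid. -/
def conjugable (δ : M) : Submonoid M where
  carrier := {w | ∀ k, δ ^ k ∣ w * δ ^ k}
  one_mem' k := by rw [one_mul]
  mul_mem' {w w'} hw hw' k := by
    obtain ⟨t, ht⟩ := hw' k
    rw [mul_assoc, ht, ← mul_assoc]
    exact (hw k).mul_right t

theorem pow_mul_mem_conjugable {g δ : M} {m : ℕ} (h : g * δ ^ m ∈ conjugable δ) :
    δ ^ m * g ∈ conjugable δ := by
  intro k
  rw [mul_assoc]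
  rcases le_total k m with hkm | hmk
  · exact (pow_dvd_pow δ hkm).mul_right _
  · obtain ⟨i, rfl⟩ := Nat.exists_eq_add_of_le hmk
    rw [pow_add, ← mul_assoc g]
    exact mul_dvd_mul_left _ (h i)

theorem mem_conjugable_of_pow_eq (hM : DivisorsComparable M) {w z δ : M} {n d : ℕ}
    (hz : z ∈ conjugable δ) (h : w ^ (n + 1) = z * δ ^ (d + 1)) : w ∈ conjugable δ := by
  have dvd_pow_mul {k i : ℕ} (hki : k ≤ d + 1 + i) : δ ^ k ∣ w ^ (n + 1) * δ ^ i := by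
    rw [h, mul_assoc, ← pow_add]
    exact (pow_dvd_pow δ hki).trans (hz _)
  intro k
  induction k using Nat.strong_induction_on with
  | _ k ih =>
    rcases k.eq_zero_or_pos with rfl | hk
    · rw [pow_zero]
      exact one_dvd _
    -- Both `δ ^ k` and `w * δ ^ k` divide `w ^ (n + 2) * δ ^ (k - (d + 1))`.
    obtain ⟨t, ht⟩ := ih (k - (d + 1)) (by lia)
    have hroot := dvd_pow_mul (k := k) (i := k - (d + 1)) (by lia)
    have hcommon : w * (w ^ (n + 1) * δ ^ (k - (d + 1))) =
        w ^ (n + 1) * δ ^ (k - (d + 1)) * t := by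
      rw [← mul_assoc, ← pow_succ', pow_succ, mul_assoc, ht, ← mul_assoc]
    have hcomparable : δ ^ k ∣ w * δ ^ k ∨ w * δ ^ k ∣ δ ^ k :=
      hM (hroot.mul_right t) (hcommon ▸ mul_dvd_mul_left w hroot)
    exact dvd_mul_of_dvd_pow_mul hcomparable (dvd_pow_mul (by lia))

theorem rightDominates_of_eq_mul {δ g w : M} (h : δ = g * w) (hw : w ∈ conjugable δ) :
    RightDominates δ g := by
  intro n
  rw [pow_succ']
  nth_rw 2 [h]
  rw [mul_assoc]
  exact mul_dvd_mul_left g (hw n)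

theorem exists_dvd_pow_of_mem_closure {S : Set M} {δ g : M} (hS : ∀ x ∈ S, RightDominates δ x)
    (hg : g ∈ Submonoid.closure S) : ∃ n, g ∣ δ ^ n := by
  induction hg using Submonoid.closure_induction_left with
  | one => exact ⟨0, one_dvd _⟩
  | mul_left x hx g _ ih =>
    obtain ⟨n, hn⟩ := ih
    exact ⟨n + 1, (mul_dvd_mul_left x hn).trans (hS x hx n)⟩

theorem isRightOType_of_rightDominates [IsLeftCancelMul M] (hunit : ∀ g : M, IsUnit g → g = 1)
    (hM : DivisorsComparable M) {S : Set M} (hS : Submonoid.closure S = ⊤) {δ : M}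
    (hδ : ∀ x ∈ S, RightDominates δ x) : IsRightOType M where
  cancel _ _ _ := mul_left_cancel
  eq_one := hunit
  total g h := by
    have dvd_pow (g : M) : ∃ n, g ∣ δ ^ n := exists_dvd_pow_of_mem_closure hδ (hS ▸ trivial)
    obtain ⟨m, hm⟩ := dvd_pow g
    obtain ⟨n, hn⟩ := dvd_pow h
    exact hM (hm.trans (pow_dvd_pow δ (le_max_left m n)))
      (hn.trans (pow_dvd_pow δ (le_max_right m n)))

end Domination

section Mirror

variable {M : Type*} [Monoid M] [StarMul M]

theorem rightDivides_of_star_dvd_star {g h : M} (hd : star g ∣ star h) : RightDivides g h := by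
  obtain ⟨k, hk⟩ := hd
  exact ⟨star k, by rw [← star_star h, hk, star_mul, star_star]⟩

theorem IsRightOType.isOType (hM : IsRightOType M) : IsOType M where
  left := hM
  right :=
    { cancel := fun h g g' e => star_injective (hM.cancel (star h) _ _ (by
        rw [← star_mul, e, star_mul]))
      eq_one := hM.eq_one
      total := fun g h => (hM.total (star g) (star h)).imp rightDivides_of_star_dvd_star
        rightDivides_of_star_dvd_star }

theorem RightDominates.dominates {δ g : M} (h : RightDominates δ g) (hδ : IsSelfAdjoint δ)
    (hg : IsSelfAdjoint g) : Dominates δ g := by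
  refine ⟨h, fun n => rightDivides_of_star_dvd_star ?_⟩
  rw [star_mul, (hδ.pow n).star_eq, (hδ.pow (n + 1)).star_eq, hg.star_eq]
  exact h n

end Mirror

/-! ### The monoid `⟨a, b, c ∣ a = b (a ^ p b) ^ q, b = c (a ^ r c) ^ s⟩⁺` -/

/-- The word `R x` for which the relations of `Mon p q r s` become `x = c * R x`, for each
generator `x`. -/
def headTail (p q r s : ℕ) : Gen₃ → FreeMonoid Gen₃
  | .a => (of .a ^ r * of .c) ^ s * (of .a ^ p * of .b) ^ q
  | .b => (of .a ^ r * of .c) ^ s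
  | .c => 1

theorem conGen_monRel (p q r s : ℕ) :
    conGen (MonRel p q r s) = headCon .c (headTail p q r s) := by
  have expand_b : headCon .c (headTail p q r s) (of .b) (of .c * (of .a ^ r * of .c) ^ s) :=
    headCon_expand .c (headTail p q r s) .b
  refine le_antisymm (Con.conGen_le.2 ?_) (headCon_le ?_)
  · rintro _ _ (_ | _)
    · refine Con.trans _ (headCon_expand .c (headTail p q r s) .a) ?_
      rw [headTail, ← mul_assoc]
      exact Con.mul _ (Con.symm _ expand_b) (Con.refl _ _)
    · exact expand_b
  · have rel_b := ConGen.Rel.of _ _ (MonRel.rel_b (p := p) (q := q) (r := r) (s := s))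
    rintro (_ | _ | _)
    · refine Con.trans _ (ConGen.Rel.of _ _ .rel_a) ?_
      rw [headTail, ← mul_assoc]
      exact Con.mul _ rel_b (Con.refl _ _)
    · exact rel_b
    · rw [headTail, mul_one]
      exact Con.refl _ _

namespace Mon

variable {p q r s : ℕ}

theorem mk_eq_mk_iff {u v : FreeMonoid Gen₃} :
    PresentedMonoid.mk (MonRel p q r s) u = PresentedMonoid.mk (MonRel p q r s) v ↔
      ∃ n, HeadDeriv .c (headTail p q r s) n u v := by
  rw [PresentedMonoid.mk_eq_mk_iff, conGen_monRel]
  rfl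

instance : IsLeftCancelMul (Mon p q r s) := by
  change IsLeftCancelMul (conGen (MonRel p q r s)).Quotient
  rw [conGen_monRel]
  exact headCon_isLeftCancelMul rfl

theorem eq_one_of_isUnit : ∀ g : Mon p q r s, IsUnit g → g = 1 := by
  change ∀ g : (conGen (MonRel p q r s)).Quotient, IsUnit g → g = 1
  rw [conGen_monRel]
  exact fun _ => headCon_eq_one_of_isUnit

theorem divisorsComparable : DivisorsComparable (Mon p q r s) := by
  change DivisorsComparable (conGen (MonRel p q r s)).Quotient
  rw [conGen_monRel]
  exact headCon_divisorsComparable rfl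

theorem of_ne_one (x : Gen₃) : PresentedMonoid.of (MonRel p q r s) x ≠ 1 := by
  change ((of x : FreeMonoid Gen₃) : (conGen (MonRel p q r s)).Quotient) ≠ 1
  rw [conGen_monRel, Ne, coe_headCon_eq_one_iff]
  exact FreeMonoid.of_ne_one x

theorem a_eq : a p q r s = b p q r s * (a p q r s ^ p * b p q r s) ^ q := by
  have h := PresentedMonoid.mk_eq_mk_of_rel (MonRel.rel_a (p := p) (q := q) (r := r) (s := s))
  simp only [map_mul, map_pow] at h
  exact h

theorem b_eq : b p q r s = c p q r s * (a p q r s ^ r * c p q r s) ^ s := by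
  have h := PresentedMonoid.mk_eq_mk_of_rel (MonRel.rel_b (p := p) (q := q) (r := r) (s := s))
  simp only [map_mul, map_pow] at h
  exact h

theorem closure_a_c : Submonoid.closure {a p q r s, c p q r s} = ⊤ := by
  have ha : a p q r s ∈ Submonoid.closure {a p q r s, c p q r s} :=
    Submonoid.subset_closure (by simp)
  have hc : c p q r s ∈ Submonoid.closure {a p q r s, c p q r s} :=
    Submonoid.subset_closure (by simp)
  have hb : b p q r s ∈ Submonoid.closure {a p q r s, c p q r s} := by
    rw [b_eq]
    exact mul_mem hc (pow_mem (mul_mem (pow_mem ha r) hc) s)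
  rw [eq_top_iff, ← PresentedMonoid.closure_range_of, Submonoid.closure_le]
  rintro _ ⟨_ | _ | _, rfl⟩
  exacts [ha, hb, hc]

section Lift

variable {N : Type*} [Monoid N] {α β γ : N}

/-- The universal property of `Mon p q r s`. -/
def lift (hα : α = β * (α ^ p * β) ^ q) (hβ : β = γ * (α ^ r * γ) ^ s) : Mon p q r s →* N :=
  PresentedMonoid.lift (fun | .a => α | .b => β | .c => γ) (by
    rintro _ _ (_ | _)
    · simpa only [map_mul, map_pow, FreeMonoid.lift_eval_of] using hα
    · simpa only [map_mul, map_pow, FreeMonoid.lift_eval_of] using hβ)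

theorem lift_a (hα : α = β * (α ^ p * β) ^ q) (hβ : β = γ * (α ^ r * γ) ^ s) :
    lift hα hβ (a p q r s) = α := rfl

theorem lift_c (hα : α = β * (α ^ p * β) ^ q) (hβ : β = γ * (α ^ r * γ) ^ s) :
    lift hα hβ (c p q r s) = γ := rfl

end Lift

/-- The mirror anti-automorphism, which fixes the generators; it exists because the defining
relations are palindromic. -/
def mirror (p q r s : ℕ) : Mon p q r s →* (Mon p q r s)ᵐᵒᵖ :=
  have op_relation {x y z : Mon p q r s} {k l : ℕ} (h : x = y * (z ^ k * y) ^ l) :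
      MulOpposite.op x =
        MulOpposite.op y * (MulOpposite.op z ^ k * MulOpposite.op y) ^ l := by
    apply MulOpposite.unop_injective
    rw [← mul_pow_mul] at h
    simpa only [MulOpposite.unop_mul, MulOpposite.unop_pow, MulOpposite.unop_op] using h
  lift (op_relation a_eq) (op_relation b_eq)

instance : StarMul (Mon p q r s) where
  star g := (mirror p q r s g).unop
  star_mul g h := by simp only [map_mul, MulOpposite.unop_mul]
  star_involutive g := by
    have hg : g ∈ Submonoid.closure {a p q r s, c p q r s} := closure_a_c ▸ trivial
    induction hg using Submonoid.closure_induction with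
    | mem g hg => rcases hg with rfl | rfl <;> rfl
    | one => simp only [map_one, MulOpposite.unop_one]
    | mul g h _ _ ihg ihh => simp only [map_mul, MulOpposite.unop_mul, ihg, ihh]

theorem isSelfAdjoint_of (x : Gen₃) : IsSelfAdjoint (PresentedMonoid.of (MonRel p q r s) x) := by
  cases x <;> rfl

theorem b_mul_pow_pow : (b p q r s * a p q r s ^ p) ^ (q + 1) = a p q r s ^ (p + 1) := by
  rw [pow_succ, ← mul_assoc, mul_pow_mul, ← a_eq, pow_succ']

theorem c_mul_pow_pow : (c p q r s * a p q r s ^ r) ^ (s + 1) = b p q r s * a p q r s ^ r := by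
  rw [pow_succ, ← mul_assoc, mul_pow_mul, ← b_eq]

theorem b_mul_pow_mem_conjugable :
    b p q r s * a p q r s ^ p ∈ conjugable (a p q r s) :=
  mem_conjugable_of_pow_eq divisorsComparable (one_mem _) (by rw [b_mul_pow_pow, one_mul])

theorem c_mul_pow_mem_conjugable (h : p ≤ r ∨ q = 0) :
    c p q r s * a p q r s ^ r ∈ conjugable (a p q r s) := by
  suffices ∃ n d, ∃ z ∈ conjugable (a p q r s),
      (c p q r s * a p q r s ^ r) ^ (n + 1) = z * a p q r s ^ (d + 1) by
    obtain ⟨n, d, z, hz, hpow⟩ := this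
    exact mem_conjugable_of_pow_eq divisorsComparable hz hpow
  obtain hpr | rfl | rfl : p < r ∨ p = r ∨ q = 0 := by lia
  · obtain ⟨d, rfl⟩ := Nat.exists_eq_add_of_lt hpr
    refine ⟨s, d, _, b_mul_pow_mem_conjugable, ?_⟩
    rw [c_mul_pow_pow, mul_assoc, ← pow_add, add_assoc]
  · refine ⟨(s + 1) * q + s, p, 1, one_mem _, ?_⟩
    rw [add_assoc, ← Nat.mul_succ, pow_mul, c_mul_pow_pow, b_mul_pow_pow, one_mul]
  · refine ⟨s, r, 1, one_mem _, ?_⟩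
    have hab : a p 0 r s = b p 0 r s := by simpa only [pow_zero, mul_one] using a_eq (q := 0)
    rw [c_mul_pow_pow, ← hab, ← pow_succ', one_mul]

theorem rightDominates_a : RightDominates (a p q r s) (a p q r s) :=
  rightDominates_of_eq_mul (mul_one _).symm (one_mem _)

theorem rightDominates_b : RightDominates (a p q r s) (b p q r s) :=
  rightDominates_of_eq_mul a_eq (pow_mem (pow_mul_mem_conjugable b_mul_pow_mem_conjugable) q)

theorem rightDominates_c (h : p ≤ r ∨ q = 0) : RightDominates (a p q r s) (c p q r s) := by
  have ha : a p q r s = c p q r s *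
      ((a p q r s ^ r * c p q r s) ^ s * (a p q r s ^ p * b p q r s) ^ q) := by
    rw [← mul_assoc, ← b_eq, ← a_eq]
  exact rightDominates_of_eq_mul ha (mul_mem
    (pow_mem (pow_mul_mem_conjugable (c_mul_pow_mem_conjugable h)) s)
    (pow_mem (pow_mul_mem_conjugable b_mul_pow_mem_conjugable) q))

theorem dominates (h : p ≤ r ∨ q = 0) (x : Gen₃) :
    Dominates (a p q r s) (PresentedMonoid.of (MonRel p q r s) x) := by
  refine RightDominates.dominates ?_ (isSelfAdjoint_of .a) (isSelfAdjoint_of x)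
  match x with
  | .a => exact rightDominates_a
  | .b => exact rightDominates_b
  | .c => exact rightDominates_c h

theorem isOType (h : p ≤ r ∨ q = 0) : IsOType (Mon p q r s) :=
  (isRightOType_of_rightDominates eq_one_of_isUnit divisorsComparable closure_a_c (by
    rintro _ (rfl | rfl)
    exacts [rightDominates_a, rightDominates_c h])).isOType

end Mon

open Gen₃ in
theorem not_headDeriv_of_lt {p q r s i j n : ℕ} (hpr : r < p) (hq : 1 ≤ q) (hs : i + j + 1 = s)
    (u v : FreeMonoid Gen₃) :
    ¬ HeadDeriv c (headTail p q r s) n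
      (of c * ((of a ^ r * of c) ^ i * (of a ^ p * u))) (of a ^ (p - r) * v) := by
  obtain ⟨d, rfl⟩ := Nat.exists_eq_add_of_lt hpr
  obtain ⟨q, rfl⟩ := Nat.exists_eq_add_of_le' hq
  have hd : r + d + 1 - r = d + 1 := by lia
  intro h
  induction n using Nat.strong_induction_on generalizing i j u v with
  | _ n ih =>
    rw [hd, pow_succ' _ d, mul_assoc (of a)] at h
    obtain ⟨⟨⟩, -⟩ | ⟨m, hm, h⟩ := h.of_mul_of_mul rfl
    have hleft : headTail (r + d + 1) (q + 1) r s c *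
        ((of a ^ r * of c) ^ i * (of a ^ (r + d + 1) * u)) =
          (of a ^ r * of c) ^ i * of a ^ r * (of a ^ (d + 1) * u) := by
      simp only [headTail, one_mul, add_assoc, pow_add _ r, mul_assoc]
    have hright : headTail (r + d + 1) (q + 1) r s a * (of a ^ d * v) =
        (of a ^ r * of c) ^ i * of a ^ r * (of c * ((of a ^ r * of c) ^ j *
          (of a ^ (r + d + 1) * (of b * (of a ^ (r + d + 1) * of b) ^ q * of a ^ d * v)))) := by
      rw [headTail, ← hs, add_right_comm, pow_add _ (i + 1), pow_succ _ i, pow_succ' _ q]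
      simp only [mul_assoc]
    rw [hleft, hright] at h
    have h' := (h.of_mul_left_cancel rfl).symm
    rw [← hd] at h'
    exact ih m hm (by rw [← hs, add_comm j]) _ _ h'

theorem Mon.not_isOType {p q r s : ℕ} (hpr : r < p) (hq : 1 ≤ q) (hs : 1 ≤ s) :
    ¬ IsOType (Mon p q r s) := by
  intro hM
  have mul_ne_mul (u v : Mon p q r s) :
      c p q r s * a p q r s ^ p * u ≠ a p q r s ^ (p - r) * v := by
    intro h
    induction u using PresentedMonoid.inductionOn with | _ u
    induction v using PresentedMonoid.inductionOn with | _ v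
    have hmk : PresentedMonoid.mk (MonRel p q r s) (of Gen₃.c * of Gen₃.a ^ p * u) =
        PresentedMonoid.mk (MonRel p q r s) (of Gen₃.a ^ (p - r) * v) := by
      simp only [map_mul, map_pow]
      exact h
    obtain ⟨n, hn⟩ := mk_eq_mk_iff.1 hmk
    refine not_headDeriv_of_lt (s := s) (i := 0) (j := s - 1) (n := n) hpr hq (by lia) u v ?_
    rwa [pow_zero, one_mul, ← mul_assoc]
  rcases hM.1.total (c p q r s * a p q r s ^ p) (a p q r s ^ (p - r)) with ⟨k, hk⟩ | ⟨k, hk⟩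
  · exact mul_ne_mul k 1 (by rw [mul_one, hk])
  · exact mul_ne_mul 1 k (by rw [mul_one, hk])

/-! ### Orderings of groups generated by a monoid of `O`-type -/

section Ordering

variable {G : Type*} [Group G]

/-- The left-invariant ordering with a given positive cone. -/
def LeftOrdering.ofCone (P : Subsemigroup G) (one_notMem : (1 : G) ∉ P)
    (mem_or : ∀ g : G, g ∈ P ∨ g = 1 ∨ g⁻¹ ∈ P) : LeftOrdering G where
  lt g h := g⁻¹ * h ∈ P
  irrefl g := by rwa [inv_mul_cancel]
  trans g h k hgh hhk := by simpa only [mul_assoc, mul_inv_cancel_left] using P.mul_mem hgh hhk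
  trichotomous g h := by
    simpa only [inv_mul_eq_one, mul_inv_rev, inv_inv] using mem_or (g⁻¹ * h)
  mul_left h g g' hlt := by simpa only [mul_inv_rev, mul_assoc, inv_mul_cancel_left] using hlt

theorem LeftOrdering.positiveCone_ofCone (P : Subsemigroup G) (one_notMem : (1 : G) ∉ P)
    (mem_or : ∀ g : G, g ∈ P ∨ g = 1 ∨ g⁻¹ ∈ P) :
    (LeftOrdering.ofCone P one_notMem mem_or).positiveCone = P := by
  ext g
  simp only [positiveCone, ofCone, inv_one, one_mul, Set.mem_ofPred_eq, SetLike.mem_coe]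

namespace LeftOrdering

theorem lt_iff (L : LeftOrdering G) (g h : G) : L.lt g h ↔ g⁻¹ * h ∈ L.positiveCone := by
  refine ⟨fun hlt => ?_, fun hlt => ?_⟩
  · have hlt' := L.mul_left g⁻¹ g h hlt
    rwa [inv_mul_cancel] at hlt'
  · simpa only [mul_one, mul_inv_cancel_left] using L.mul_left g 1 (g⁻¹ * h) hlt

theorem eq_of_positiveCone_subset {L L' : LeftOrdering G}
    (hsub : L.positiveCone ⊆ L'.positiveCone) : L = L' := by
  have lt_of_lt {g h : G} (hlt : L.lt g h) : L'.lt g h :=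
    (L'.lt_iff g h).2 (hsub ((L.lt_iff g h).1 hlt))
  ext g h
  refine ⟨lt_of_lt, fun hlt => ?_⟩
  rcases L.trichotomous g h with hgh | rfl | hhg
  · exact hgh
  · exact (L'.irrefl g hlt).elim
  · exact (L'.irrefl g (L'.trans _ _ _ hlt (lt_of_lt hhg))).elim

theorem isOpen_setOf_lt (g h : G) : IsOpen {L : LeftOrdering G | L.lt g h} := by
  refine isOpen_induced_iff.2 ⟨{f | f (g, h) = true}, ?_, ?_⟩
  · exact (isOpen_discrete ({true} : Set Bool)).preimage
      (continuous_apply (A := fun _ : G × G => Bool) (g, h))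
  · ext L
    simp only [Set.preimage_ofPred_eq, decide_eq_true_eq]

/-- The positive cone as a subsemigroup. -/
def positiveSubsemigroup (L : LeftOrdering G) : Subsemigroup G where
  carrier := L.positiveCone
  mul_mem' {g h} hg hh := L.trans 1 g (g * h) hg (by simpa only [mul_one] using L.mul_left g 1 h hh)

theorem isolated_of_positiveCone_eq_closure {L : LeftOrdering G} {S : Set G} (hS : S.Finite)
    (hL : L.positiveCone = Subsemigroup.closure S) : L.Isolated := by
  have hsingleton : {L} = ⋂ g ∈ S, {L' : LeftOrdering G | L'.lt 1 g} := by
    ext L'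
    simp only [Set.mem_singleton_iff, Set.mem_iInter, Set.mem_ofPred_eq]
    refine ⟨?_, fun h => (eq_of_positiveCone_subset ?_).symm⟩
    · rintro rfl g hg
      exact hL.ge (Subsemigroup.subset_closure hg)
    · rw [hL]
      exact (Subsemigroup.closure_le (S := L'.positiveSubsemigroup)).2 h
  rw [Isolated, hsingleton]
  exact hS.isOpen_biInter fun g _ => isOpen_setOf_lt 1 g

end LeftOrdering

theorem exists_injective_monoidHom_of_ore.{u} {M : Type u} [Monoid M] [IsCancelMul M]
    (hM : ∀ m n : M, ∃ k l, k * m = l * n) :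
    ∃ (K : Type u) (_ : Group K) (f : M →* K), Function.Injective f := by
  choose den num hore using hM
  let _ : OreLocalization.OreSet (⊤ : Submonoid M) :=
    { ore_right_cancel := fun m n k h => ⟨1, by rw [mul_right_cancel h]⟩
      oreNum := fun m n => num m n
      oreDenom := fun m n => ⟨den m n, trivial⟩
      ore_eq := fun m n => hore m n }
  let numerator : M →* OreLocalization (⊤ : Submonoid M) M := OreLocalization.numeratorHom
  have isUnit_numerator (m : M) : IsUnit (numerator m) :=
    OreLocalization.numerator_isUnit (⟨m, trivial⟩ : (⊤ : Submonoid M))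
  refine ⟨_, inferInstance, IsUnit.liftRight numerator isUnit_numerator, fun m n h => ?_⟩
  have hmn : numerator m = numerator n := congrArg Units.val h
  obtain ⟨u, v, hnum, hden⟩ := OreLocalization.oreDiv_eq_iff.1 hmn
  simp only [smul_eq_mul, Submonoid.smul_def, Submonoid.coe_one, mul_one] at hnum hden
  rw [hden] at hnum
  exact (mul_left_cancel hnum).symm

namespace IsOType

variable {M : Type*} [Monoid M]

theorem isCancelMul (hM : IsOType M) : IsCancelMul M where
  mul_left_cancel := hM.1.cancel
  mul_right_cancel h _ _ := hM.2.cancel h _ _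

theorem exists_mul_eq_mul (hM : IsOType M) (m n : M) : ∃ k l, k * m = l * n := by
  rcases hM.2.total m n with ⟨k, rfl⟩ | ⟨k, rfl⟩
  exacts [⟨k, 1, (one_mul _).symm⟩, ⟨1, k, one_mul _⟩]

theorem mem_range_or_inv_mem_range (hM : IsOType M) {f : M →* G}
    (hf : Subgroup.closure (Set.range f) = ⊤) (g : G) : g ∈ Set.range f ∨ g⁻¹ ∈ Set.range f := by
  let H : Subgroup G :=
    { carrier := {g | g ∈ Set.range f ∨ g⁻¹ ∈ Set.range f}
      one_mem' := .inl ⟨1, map_one f⟩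
      inv_mem' := fun {g} hg => by simpa only [Set.mem_ofPred_eq, inv_inv, or_comm] using hg
      mul_mem' := by
        rintro g h (⟨m, rfl⟩ | ⟨m, hm⟩) (⟨n, rfl⟩ | ⟨n, hn⟩)
        · exact .inl ⟨m * n, map_mul f m n⟩
        · obtain rfl : h = (f n)⁻¹ := by rw [hn, inv_inv]
          rcases hM.2.total m n with ⟨k, rfl⟩ | ⟨k, rfl⟩
          · exact .inr ⟨k, by rw [map_mul]; group⟩
          · exact .inl ⟨k, by rw [map_mul]; group⟩
        · obtain rfl : g = (f m)⁻¹ := by rw [hm, inv_inv]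
          rcases hM.1.total m n with ⟨k, rfl⟩ | ⟨k, rfl⟩
          · exact .inl ⟨k, by rw [map_mul]; group⟩
          · exact .inr ⟨k, by rw [map_mul]; group⟩
        · exact .inr ⟨n * m, by rw [map_mul, hm, hn, mul_inv_rev]⟩ }
  have hH : Subgroup.closure (Set.range f) ≤ H := (Subgroup.closure_le H).2 fun _ => .inl
  exact hH (hf ▸ trivial)

theorem coe_subsemigroup_closure (hM : IsOType M) {S : Set M} (hS : Submonoid.closure S = ⊤)
    (h1 : 1 ∉ S) : (Subsemigroup.closure S : Set M) = {m | m ≠ 1} := by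
  refine Set.Subset.antisymm (fun m hm => ?_) (fun m hm => ?_)
  · induction hm using Subsemigroup.closure_induction with
    | mem m hm => exact ne_of_mem_of_not_mem hm h1
    | mul m n _ _ _ hn =>
      have := hM.isCancelMul
      exact fun hmn => hn (hM.1.eq_one n (.of_mul_eq_one_right m hmn))
  · have hm' : m ∈ (Submonoid.closure S : Set M) := hS ▸ trivial
    rw [Submonoid.closure_eq_one_union] at hm'
    exact hm'.resolve_left hm

theorem exists_leftOrdering (hM : IsOType M) {f : M →* G} (hf : Function.Injective f)
    (hG : Subgroup.closure (Set.range f) = ⊤) {S : Set M} (hS : Submonoid.closure S = ⊤)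
    (h1 : 1 ∉ S) : ∃ L : LeftOrdering G, L.positiveCone = Subsemigroup.closure (f '' S) := by
  have hcone : (Subsemigroup.closure (f '' S) : Set G) = f '' {m | m ≠ 1} := by
    rw [← hM.coe_subsemigroup_closure hS h1]
    exact congrArg SetLike.coe (MulHom.map_mclosure (f : M →ₙ* G) S).symm
  have one_notMem : (1 : G) ∉ Subsemigroup.closure (f '' S) := by
    rw [← SetLike.mem_coe, hcone]
    rintro ⟨m, hm, hfm⟩
    exact hm (hf (hfm.trans (map_one f).symm))
  have mem_of_mem_range {g : G} (hg : g ∈ Set.range f) (hg1 : g ≠ 1) :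
      g ∈ Subsemigroup.closure (f '' S) := by
    rw [← SetLike.mem_coe, hcone]
    obtain ⟨m, rfl⟩ := hg
    exact ⟨m, fun hm => hg1 (hm ▸ map_one f), rfl⟩
  refine ⟨.ofCone _ one_notMem fun g => ?_, LeftOrdering.positiveCone_ofCone _ _ _⟩
  by_cases hg1 : g = 1
  · exact .inr (.inl hg1)
  · exact (hM.mem_range_or_inv_mem_range hG g).imp (mem_of_mem_range · hg1)
      fun hg => .inr (mem_of_mem_range hg (inv_ne_one.2 hg1))

end IsOType

end Ordering

/-! ### The embedding of the monoid into the group -/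

section Relation

variable {M : Type*} [Monoid M] [IsRightCancelMul M]

/-- The relation of `Gp p q r s`, with `y` written as `c * x ^ p`, is the relation that remains when
`b` is eliminated from the relations of `Mon p q r s`, multiplied by `x ^ p` on the right. -/
theorem pow_eq_iff_eq_mul_pow {p r : ℕ} (hpr : p ≤ r) (q s : ℕ) (x c : M) :
    x ^ (p + 1) = (c * x ^ p * (x ^ (r - p) * (c * x ^ p)) ^ s) ^ (q + 1) ↔
      x = c * (x ^ r * c) ^ s * (x ^ p * (c * (x ^ r * c) ^ s)) ^ q := by
  have hbase : c * x ^ p * (x ^ (r - p) * (c * x ^ p)) ^ s = c * (x ^ r * c) ^ s * x ^ p := by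
    rw [← mul_assoc (x ^ (r - p)), mul_assoc c, ← mul_pow_mul, ← mul_assoc (x ^ p), ← pow_add,
      Nat.add_sub_cancel' hpr, mul_assoc]
  rw [hbase, pow_succ _ q, ← mul_assoc, mul_pow_mul, pow_succ', mul_left_inj]

end Relation

namespace Gp

variable {p q r s : ℕ}

theorem relation :
    x p q r s ^ (p + 1) = (y p q r s * (x p q r s ^ (r - p) * y p q r s) ^ s) ^ (q + 1) :=
  mul_inv_eq_one.1 (PresentedGroup.one_of_mem (Set.mem_singleton _))

section Lift

variable {K : Type*} [Group K] {ξ η : K}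

/-- The universal property of `Gp p q r s`. -/
def lift (h : ξ ^ (p + 1) = (η * (ξ ^ (r - p) * η) ^ s) ^ (q + 1)) : Gp p q r s →* K :=
  PresentedGroup.toGroup (f := fun | .x => ξ | .y => η) (by
    rintro _ rfl
    simpa only [map_mul, map_pow, map_inv, FreeGroup.lift_apply_of, mul_inv_eq_one] using h)

theorem lift_x (h : ξ ^ (p + 1) = (η * (ξ ^ (r - p) * η) ^ s) ^ (q + 1)) :
    lift h (x p q r s) = ξ :=
  PresentedGroup.toGroup.of _

theorem lift_y (h : ξ ^ (p + 1) = (η * (ξ ^ (r - p) * η) ^ s) ^ (q + 1)) :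
    lift h (y p q r s) = η :=
  PresentedGroup.toGroup.of _

end Lift

end Gp

namespace Mon

variable {p q r s : ℕ}

/-- The homomorphism to the group given by `a ↦ x` and `c ↦ y * x⁻ᵖ`. -/
def toGp (q s : ℕ) (hpr : p ≤ r) : Mon p q r s →* Gp p q r s :=
  lift (α := Gp.x p q r s) (γ := Gp.y p q r s * (Gp.x p q r s ^ p)⁻¹)
    ((pow_eq_iff_eq_mul_pow hpr q s _ _).1 (by
      simpa only [inv_mul_cancel_right] using Gp.relation (p := p) (q := q) (r := r) (s := s)))
    rfl

theorem toGp_a (hpr : p ≤ r) : toGp q s hpr (a p q r s) = Gp.x p q r s :=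
  lift_a _ _

theorem toGp_c (hpr : p ≤ r) :
    toGp q s hpr (c p q r s) = Gp.y p q r s * (Gp.x p q r s ^ p)⁻¹ :=
  lift_c _ _

theorem closure_range_toGp (hpr : p ≤ r) : Subgroup.closure (Set.range (toGp q s hpr)) = ⊤ := by
  rw [eq_top_iff, ← PresentedGroup.closure_range_of]
  refine Subgroup.closure_mono ?_
  rintro _ ⟨_ | _, rfl⟩
  · exact ⟨a p q r s, toGp_a hpr⟩
  · exact ⟨c p q r s * a p q r s ^ p, by
      rw [map_mul, map_pow, toGp_a, toGp_c, inv_mul_cancel_right, Gp.y]⟩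

theorem toGp_injective (hpr : p ≤ r) : Function.Injective (toGp q s hpr) := by
  have hM : IsOType (Mon p q r s) := isOType (.inl hpr)
  have := hM.isCancelMul
  obtain ⟨K, _, f, hf⟩ := exists_injective_monoidHom_of_ore hM.exists_mul_eq_mul
  have hrel : f (a p q r s) ^ (p + 1) = (f (c p q r s * a p q r s ^ p) *
      (f (a p q r s) ^ (r - p) * f (c p q r s * a p q r s ^ p)) ^ s) ^ (q + 1) := by
    simp only [← map_pow, ← map_mul]
    refine congrArg f ((pow_eq_iff_eq_mul_pow hpr q s _ _).2 ?_)
    rw [← b_eq, ← a_eq]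
  have hcomp : (Gp.lift hrel).comp (toGp q s hpr) = f := by
    refine MonoidHom.eq_of_eqOn_denseM closure_a_c ?_
    rintro _ (rfl | rfl)
    · rw [MonoidHom.comp_apply, toGp_a, Gp.lift_x]
    · rw [MonoidHom.comp_apply, toGp_c, map_mul, map_inv, map_pow, Gp.lift_x, Gp.lift_y, map_mul,
        map_pow, mul_inv_cancel_right]
  exact .of_comp (f := Gp.lift hrel) (by rwa [← MonoidHom.coe_comp, hcomp])

end Mon

namespace Gp

theorem exists_leftOrdering {p r : ℕ} (q s : ℕ) (hpr : p ≤ r) :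
    ∃ L : LeftOrdering (Gp p q r s),
      L.positiveCone = Subsemigroup.closure {x p q r s, y p q r s * (x p q r s ^ p)⁻¹} := by
  have one_notMem : 1 ∉ ({Mon.a p q r s, Mon.c p q r s} : Set (Mon p q r s)) := by
    rintro (h | h)
    exacts [Mon.of_ne_one .a h.symm, Mon.of_ne_one .c h.symm]
  rw [← Mon.toGp_c hpr, ← Mon.toGp_a hpr, ← Set.image_pair]
  exact (Mon.isOType (.inl hpr)).exists_leftOrdering (Mon.toGp_injective hpr)
    (Mon.closure_range_toGp hpr) Mon.closure_a_c one_notMem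

end Gp

end OTypeMonoid

theorem corollary8p8 (p q r s : ℕ) :
    (p ≤ r →
      OTypeMonoid.LeftOrderable (OTypeMonoid.Gp p q r s) ∧
      ∃ L : OTypeMonoid.LeftOrdering (OTypeMonoid.Gp p q r s),
        L.positiveCone =
          (Subsemigroup.closure
            {OTypeMonoid.Gp.x p q r s,
              OTypeMonoid.Gp.y p q r s * (OTypeMonoid.Gp.x p q r s ^ p)⁻¹} :
            Set (OTypeMonoid.Gp p q r s)) ∧
        L.Isolated) ∧
    (p ≤ r ∨ q = 0 →
      (OTypeMonoid.Dominates (OTypeMonoid.Mon.a p q r s) (OTypeMonoid.Mon.a p q r s) ∧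
        OTypeMonoid.Dominates (OTypeMonoid.Mon.a p q r s) (OTypeMonoid.Mon.b p q r s) ∧
        OTypeMonoid.Dominates (OTypeMonoid.Mon.a p q r s) (OTypeMonoid.Mon.c p q r s)) ∧
      OTypeMonoid.IsOType (OTypeMonoid.Mon p q r s)) ∧
    (r < p → 1 ≤ q → 1 ≤ s → ¬ OTypeMonoid.IsOType (OTypeMonoid.Mon p q r s)) := by
  refine ⟨fun hpr => ?_, fun h => ⟨⟨?_, ?_, ?_⟩, OTypeMonoid.Mon.isOType h⟩,
    OTypeMonoid.Mon.not_isOType⟩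
  · obtain ⟨L, hL⟩ := OTypeMonoid.Gp.exists_leftOrdering q s hpr
    exact ⟨⟨L⟩, L, hL,
      OTypeMonoid.LeftOrdering.isolated_of_positiveCone_eq_closure (Set.toFinite _) hL⟩
  · exact OTypeMonoid.Mon.dominates h .a
  · exact OTypeMonoid.Mon.dominates h .b
  · exact OTypeMonoid.Mon.dominates h .c
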